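/- Let $G$ be a finite simple graph with $n$ vertices and no isolated vertices, and let $\Phi=(G,\varphi)$ be a gain graph on $G$: every oriented edge $\overrightarrow{e_{ij}}$ of $G$ carries a gain $\varphi(\overrightarrow{e_{ij}})\in\mathbb{C}$ of modulus $1$, with $\varphi(\overrightarrow{e_{ji}})=\varphi(\overrightarrow{e_{ij}})^{-1}$. Let $d_\Phi(v)$ denote the degree of $v$ in $G$, and let $\mathcal{L}(\Phi)$ be the gain normalized Laplacian, i.e. the $n\times n$ matrix with diagonal entries $1$, with entries $-\varphi(\overrightarrow{e_{ij}})/\sqrt{d_\Phi(v_i)d_\Phi(v_j)}$ if $v_i\sim v_j$, and all other entries $0$. Write its characteristic polynomial $\Gamma(x,\mathcal{L}(\Phi))=\det(xI-\mathcal{L}(\Phi))$ in powers of $x-1$ as $$\Gamma(x,\mathcal{L}(\Phi))=(x-1)^n+c_1(x-1)^{n-1}+c_2(x-1)^{n-2}+\dots+c_n .$$ Then for every $k=1,\dots,n$ $$c_k=\sum_{H}(-1)^{r(H)}\,2^{s(H)}\,\frac{\prod_{C\in\mathcal{C}(H)}\operatorname{Re}(\varphi(C))}{\prod_{v\in V(H)}d_\Phi(v)},$$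 where the sum runs over all elementary subgraphs $H$ of $G$ with exactly $k$ vertices, that is, the subgraphs each of whose connected components is either a single edge (with its two ends) or a cycle of length at least $3$. Here $\mathcal{C}(H)$ is the set of components of $H$ that are cycles; $\varphi(C)$ is the product of the gains of the oriented edges met when going once around $C$ (its real part does not depend on the starting point or the direction); and $r(H)=|V(H)|-p(H)$ and $s(H)=|E(H)|-|V(H)|+p(H)$, where $p(H)$ is the number of connected components of $H$. -/

import Mathlib

/-- A `𝕋`-gain graph with underlying simple graph `G`: every oriented edge carries a unit complex
number, and reversing an edge inverts its gain. -/
structure GainGraph {V : Type*} (G : SimpleGraph V) where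
  gain : G.Dart → Circle
  gain_symm : ∀ d : G.Dart, gain d.symm = (gain d)⁻¹

namespace GainGraph

variable {V : Type*} {G : SimpleGraph V}

/-- The gain of a walk: the product of the gains of its oriented edges. -/
noncomputable def walkGain (Φ : GainGraph G) {u v : V} (w : G.Walk u v) : Circle :=
  (w.darts.map Φ.gain).prod

/-- The gain normalized Laplacian `𝓛(Φ)`. -/
noncomputable def normalizedLaplacian [Fintype V] [DecidableEq V] [DecidableRel G.Adj]
    (Φ : GainGraph G) : Matrix V V ℂ :=
  Matrix.of fun i j =>
    if i = j then (if G.degree i ≠ 0 then 1 else 0)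
    else if h : G.Adj i j then
      -(Φ.gain ⟨(i, j), h⟩ : ℂ) / (Real.sqrt ((G.degree i : ℝ) * (G.degree j : ℝ)) : ℂ)
    else 0

end GainGraph

namespace SimpleGraph.Subgraph

variable {V : Type*} {G : SimpleGraph V}

/-- The connected components of a subgraph `H` of `G`, viewed as subgraphs of `G`. -/
def components (H : G.Subgraph) : Set G.Subgraph :=
  Set.range fun c : H.coe.ConnectedComponent => Subgraph.coeSubgraph c.toSubgraph

/-- The subgraph is a single edge together with its two ends. -/
def IsSingleEdge (K : G.Subgraph) : Prop :=
  ∃ (u v : V) (h : G.Adj u v), K = G.subgraphOfAdj h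

/-- The subgraph is a cycle (of length at least three). -/
def IsCycleSubgraph (K : G.Subgraph) : Prop :=
  ∃ (u : V) (w : G.Walk u u), w.IsCycle ∧ w.toSubgraph = K

/-- Every connected component is an edge or a cycle. -/
def IsElementary (H : G.Subgraph) : Prop :=
  ∀ K ∈ H.components, K.IsSingleEdge ∨ K.IsCycleSubgraph

/-- The number of connected components `p(H)`. -/
noncomputable def numComponents (H : G.Subgraph) : ℕ :=
  Nat.card H.coe.ConnectedComponent

/-- The rank `r(H) = |V(H)| - p(H)`. -/
noncomputable def rank (H : G.Subgraph) : ℤ :=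
  (H.verts.ncard : ℤ) - H.numComponents

/-- The corank `s(H) = |E(H)| - |V(H)| + p(H)`. -/
noncomputable def corank (H : G.Subgraph) : ℤ :=
  (H.edgeSet.ncard : ℤ) - H.verts.ncard + H.numComponents

/-- The vertex set `V(H)` as a finset. -/
noncomputable def vertexFinset [Finite V] (H : G.Subgraph) : Finset V :=
  (Set.toFinite H.verts).toFinset

/-- The set `𝒞(H)` of the components of `H` that are cycles. -/
noncomputable def cycles [Finite V] (H : G.Subgraph) : Finset G.Subgraph :=
  (Set.toFinite {K : G.Subgraph | K ∈ H.components ∧ K.IsCycleSubgraph}).toFinset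

end SimpleGraph.Subgraph

/-- The elementary subgraphs of `G` with exactly `k` vertices. -/
noncomputable def SimpleGraph.elementarySubgraphs {V : Type*} [Finite V] (G : SimpleGraph V)
    (k : ℕ) : Finset G.Subgraph :=
  (Set.toFinite {H : G.Subgraph | H.IsElementary ∧ H.verts.ncard = k}).toFinset

open scoped Classical in
/-- `Re(φ(C))` for a cycle `C`: the real part of the gain of a closed walk running once around `C`
(see `GainGraph.reCycleGain_eq`: neither the starting point nor the orientation matters). The value
on subgraphs that are not cycles is irrelevant. -/
noncomputable def GainGraph.reCycleGain {V : Type*} {G : SimpleGraph V} (Φ : GainGraph G)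
    (C : G.Subgraph) : ℝ :=
  if h : C.IsCycleSubgraph then ((Φ.walkGain h.choose_spec.choose : Circle) : ℂ).re else 0

theorem SimpleGraph.Walk.IsCycle.eq_of_toSubgraph_eq {V : Type*} {G : SimpleGraph V} {u : V}
    {p q : G.Walk u u} (hp : p.IsCycle) (hq : q.IsCycle) (h : p.toSubgraph = q.toSubgraph)
    (hs : p.snd = q.snd) : p = q := by
  have hl : p.length = q.length := by
    rw [← SimpleGraph.Walk.length_edges, ← SimpleGraph.Walk.length_edges]
    refine ((List.perm_ext_iff_of_nodup hp.edges_nodup hq.edges_nodup).2 fun e => ?_).length_eq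
    rw [← p.mem_edges_toSubgraph, ← q.mem_edges_toSubgraph, h]
  have key : ∀ i, i + 1 ≤ p.length →
      p.getVert i = q.getVert i ∧ p.getVert (i + 1) = q.getVert (i + 1) := by
    intro i
    induction i with
    | zero => intro _; exact ⟨by simp, by simpa using hs⟩
    | succ i ih =>
      intro hi
      obtain ⟨h1, h2⟩ := ih (by omega)
      refine ⟨h2, ?_⟩
      have e1 := hp.neighborSet_toSubgraph_internal (i := i + 1) (by omega) (by omega)
      have e2 := hq.neighborSet_toSubgraph_internal (i := i + 1) (by omega) (by omega)
      rw [h, h2, e2] at e1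
      have n1 := hp.getVert_sub_one_ne_getVert_add_one (i := i + 1) (by omega)
      have m : p.getVert (i + 1 + 1) ∈
          ({q.getVert (i + 1 - 1), q.getVert (i + 1 + 1)} : Set V) := by
        rw [e1]; simp
      simp only [Nat.add_sub_cancel] at m n1
      rcases m with m | m
      · exact absurd (h1.trans m.symm) n1
      · exact m
  refine SimpleGraph.Walk.ext_getVert_le_length hl fun k hk => ?_
  rcases k with _ | k
  · simp
  · exact (key k hk).2

/-- The real part of the gain of a cycle depends neither on its starting point nor on its
orientation. -/
theorem GainGraph.reCycleGain_eq {V : Type*} {G : SimpleGraph V} (Φ : GainGraph G) {u : V}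
    (w : G.Walk u u) (hw : w.IsCycle) :
    Φ.reCycleGain w.toSubgraph = ((Φ.walkGain w : Circle) : ℂ).re := by
  classical
  have h : w.toSubgraph.IsCycleSubgraph := ⟨u, w, hw, rfl⟩
  rw [GainGraph.reCycleGain, dif_pos h]
  obtain ⟨hc, hs⟩ := h.choose_spec.choose_spec
  generalize h.choose_spec.choose = q at hc hs
  have hu : u ∈ q.support := by
    rw [← q.mem_verts_toSubgraph, hs]; exact w.start_mem_verts_toSubgraph
  have hrot : Φ.walkGain (q.rotate u hu) = Φ.walkGain q :=
    (((q.rotate_darts u hu).map Φ.gain).perm).prod_eq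
  rw [← hrot]
  have hc' := hc.rotate hu
  have hs' : (q.rotate u hu).toSubgraph = w.toSubgraph := by rw [q.toSubgraph_rotate, hs]
  generalize q.rotate u hu = r at hc' hs'
  have m : r.snd ∈ w.toSubgraph.neighborSet u := by
    rw [← hs', hc'.neighborSet_toSubgraph_endpoint]; simp
  rw [hw.neighborSet_toSubgraph_endpoint] at m
  rcases m with m | m
  · rw [hc'.eq_of_toSubgraph_eq hw hs' m]
  · have hr : r = w.reverse :=
      hc'.eq_of_toSubgraph_eq hw.reverse (by rw [hs', w.toSubgraph_reverse])
        (by rw [w.snd_reverse]; exact m)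
    have hinv : Φ.walkGain w.reverse = (Φ.walkGain w)⁻¹ := by
      simp only [GainGraph.walkGain, SimpleGraph.Walk.darts_reverse, List.map_reverse,
        List.prod_reverse, List.map_map]
      rw [List.prod_inv, List.map_map]
      congr 2
      funext d
      simp [Φ.gain_symm]
    rw [hr, hinv, Circle.coe_inv_eq_conj, Complex.conj_re]

/-! Expand the characteristic polynomial by the Leibniz formula. A permutation `σ` contributes a
factor `X - 1` for each fixed point and `gain(i, σ i) / √(d i * d (σ i))` for each moved point.
Since `σ` permutes its support, the square roots multiply to the product of the degrees over the
support. So the coefficient of `(X - 1) ^ (n - k)` is the sum of `permWeight` over the permutations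
moving exactly `k` points, and only those moving points along edges count.

Sort these by `permSubgraph`: the components of `permSubgraph σ` come from the disjoint cycles of
`σ`, so it is elementary. Conversely, a permutation with subgraph `H` amounts to an independent
choice, for each component, of a cyclic permutation running around it. The weight is multiplicative
over disjoint cycles, so the sum over a fibre factors (`sum_eq_prod_sum_cyclesOver`). An edge
carries one transposition, of weight `-1 / (d u * d v)`. A cycle carries exactly two permutations,
`c` and `c⁻¹` (`eq_or_eq_inv_of_permSubgraph_eq`), with conjugate weights: this produces `2 Re
φ(C)`. The signs multiply to `(-1) ^ r(H)`, and `s(H)` is the number of cycles. -/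

namespace SimpleGraph.Subgraph

/-! ### Components of a subgraph, and quantities additive over them. -/

variable {V : Type*} {G : SimpleGraph V}

/-- A connected subgraph is contained in every vertex set that it meets and that is closed under
its adjacency. -/
theorem Connected.verts_subset_of_closed {K : G.Subgraph} (hK : K.Connected) {S : Set V} {u : V}
    (hu : u ∈ K.verts) (huS : u ∈ S) (hS : ∀ x ∈ S, ∀ y, K.Adj x y → y ∈ S) : K.verts ⊆ S := by
  intro x hx
  have h : K.coe.Reachable ⟨u, hu⟩ ⟨x, hx⟩ := hK.coe.preconnected _ _
  rw [SimpleGraph.reachable_iff_reflTransGen] at h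
  have key : ∀ y : K.verts, Relation.ReflTransGen K.coe.Adj ⟨u, hu⟩ y → (y : V) ∈ S := by
    intro y hy
    induction hy with
    | refl => exact huS
    | tail _ hbc ih => exact hS _ ih _ hbc
  exact key _ h

/-- A component is determined by any one of its vertices; this normal form makes two components
sharing a vertex equal by `rfl`. -/
theorem mem_components_verts {H K : G.Subgraph} (hK : K ∈ H.components) {u : V}
    (hu : u ∈ K.verts) : ∃ h : u ∈ H.verts, K = Subgraph.coeSubgraph
      (H.coe.connectedComponentMk ⟨u, h⟩).toSubgraph := by
  obtain ⟨c, rfl⟩ := hK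
  rw [verts_coeSubgraph] at hu
  obtain ⟨⟨x, hx⟩, hxc, rfl⟩ := hu
  refine ⟨hx, ?_⟩
  have : H.coe.connectedComponentMk ⟨x, hx⟩ = c := hxc
  rw [this]

theorem connected_of_mem_components {H K : G.Subgraph} (hK : K ∈ H.components) :
    K.Connected := by
  obtain ⟨c, rfl⟩ := hK
  exact c.connected_toSubgraph.coeSubgraph

theorem nonempty_of_mem_components {H K : G.Subgraph} (hK : K ∈ H.components) :
    K.verts.Nonempty := (connected_of_mem_components hK).nonempty

theorem eq_of_mem_components {H K K' : G.Subgraph} (hK : K ∈ H.components)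
    (hK' : K' ∈ H.components) {u : V} (hu : u ∈ K.verts) (hu' : u ∈ K'.verts) : K = K' := by
  obtain ⟨h, rfl⟩ := mem_components_verts hK hu
  obtain ⟨h', rfl⟩ := mem_components_verts hK' hu'
  rfl

theorem le_of_mem_components {H K : G.Subgraph} (hK : K ∈ H.components) : K ≤ H := by
  obtain ⟨c, rfl⟩ := hK
  exact coeSubgraph_le _

theorem exists_mem_components {H : G.Subgraph} {u : V} (hu : u ∈ H.verts) :
    ∃ K ∈ H.components, u ∈ K.verts := by
  refine ⟨_, ⟨H.coe.connectedComponentMk ⟨u, hu⟩, rfl⟩, ?_⟩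
  rw [verts_coeSubgraph]
  exact ⟨⟨u, hu⟩, rfl, rfl⟩

theorem adj_of_mem_components {H K : G.Subgraph} (hK : K ∈ H.components) {u v : V}
    (hu : u ∈ K.verts) (h : H.Adj u v) : K.Adj u v := by
  obtain ⟨hu', rfl⟩ := mem_components_verts hK hu
  rw [coeSubgraph_adj]
  have hv' := h.snd_mem
  have hadj : H.coe.Adj ⟨u, hu'⟩ ⟨v, hv'⟩ := h
  refine ⟨hu', hv', ?_, ?_, hadj⟩
  · exact rfl
  · exact (SimpleGraph.ConnectedComponent.sound hadj.reachable).symm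

/-- A connected subgraph of `H` closed under the adjacency of `H` is a component of `H`. -/
theorem mem_components_of_closed {H K : G.Subgraph} (hK : K.Connected) (hle : K ≤ H)
    (hcl : ∀ u ∈ K.verts, ∀ v, H.Adj u v → K.Adj u v) : K ∈ H.components := by
  obtain ⟨u, hu⟩ := hK.nonempty
  obtain ⟨C, hC, huC⟩ := exists_mem_components (hle.1 hu)
  have h1 : K.verts ⊆ C.verts := hK.verts_subset_of_closed hu huC fun x hx y hxy =>
    (adj_of_mem_components hC hx (hle.2 hxy)).snd_mem
  have h2 : C.verts ⊆ K.verts :=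
    (connected_of_mem_components hC).verts_subset_of_closed huC hu fun x hx y hxy =>
      (hcl x hx y ((le_of_mem_components hC).2 hxy)).snd_mem
  have : K = C := by
    refine Subgraph.ext (h1.antisymm h2) ?_
    funext x y
    refine propext ⟨fun h => adj_of_mem_components hC (h1 h.fst_mem) (hle.2 h), fun h => ?_⟩
    exact hcl x (h2 h.fst_mem) y ((le_of_mem_components hC).2 h)
  exact this ▸ hC

theorem numComponents_eq_ncard (H : G.Subgraph) : H.numComponents = H.components.ncard := by
  rw [numComponents, components, ← Nat.card_coe_set_eq]
  refine (Nat.card_range_of_injective ?_).symm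
  intro c d h
  have h' := coeSubgraph_injective _ h
  have hv : c.supp = d.supp := congrArg Subgraph.verts h'
  exact SimpleGraph.ConnectedComponent.supp_injective hv

theorem eq_of_components_eq {H H' : G.Subgraph} (h : H.components = H'.components) : H = H' := by
  have key : ∀ {A B : G.Subgraph}, A.components = B.components → A ≤ B := by
    intro A B h
    refine ⟨fun x hx => ?_, fun x y hxy => ?_⟩
    · obtain ⟨K, hK, hxK⟩ := exists_mem_components hx
      exact (le_of_mem_components (h ▸ hK)).1 hxK
    · obtain ⟨K, hK, hxK⟩ := exists_mem_components hxy.fst_mem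
      exact (le_of_mem_components (h ▸ hK)).2 (adj_of_mem_components hK hxK hxy)
  exact le_antisymm (key h) (key h.symm)

/-- The components of `H` as a finset. -/
noncomputable def componentFinset [Finite V] (H : G.Subgraph) : Finset G.Subgraph :=
  (Set.toFinite H.components).toFinset

theorem mem_componentFinset [Finite V] {H K : G.Subgraph} :
    K ∈ H.componentFinset ↔ K ∈ H.components := by simp [componentFinset]

theorem mem_vertexFinset [Finite V] {H : G.Subgraph} {v : V} :
    v ∈ H.vertexFinset ↔ v ∈ H.verts := by simp [vertexFinset]

theorem card_vertexFinset [Finite V] (H : G.Subgraph) : H.vertexFinset.card = H.verts.ncard := by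
  rw [vertexFinset, Set.ncard_eq_toFinset_card]

theorem vertexFinset_eq_biUnion [Finite V] [DecidableEq V] (H : G.Subgraph) :
    H.vertexFinset = H.componentFinset.biUnion vertexFinset := by
  ext v
  simp only [Finset.mem_biUnion, mem_vertexFinset, mem_componentFinset]
  exact ⟨exists_mem_components, fun ⟨K, hK, hv⟩ => (le_of_mem_components hK).1 hv⟩

theorem pairwiseDisjoint_vertexFinset [Finite V] (H : G.Subgraph) :
    (H.componentFinset : Set G.Subgraph).PairwiseDisjoint vertexFinset := by
  intro K hK K' hK' hne
  refine Finset.disjoint_left.2 fun v hv hv' => hne ?_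
  exact eq_of_mem_components (mem_componentFinset.1 hK) (mem_componentFinset.1 hK')
    (mem_vertexFinset.1 hv) (mem_vertexFinset.1 hv')

theorem prod_vertexFinset [Finite V] {M : Type*} [CommMonoid M] (H : G.Subgraph) (f : V → M) :
    ∏ v ∈ H.vertexFinset, f v = ∏ K ∈ H.componentFinset, ∏ v ∈ K.vertexFinset, f v := by
  classical
  rw [vertexFinset_eq_biUnion, Finset.prod_biUnion H.pairwiseDisjoint_vertexFinset]

theorem ncard_verts_eq_sum [Finite V] (H : G.Subgraph) :
    H.verts.ncard = ∑ K ∈ H.componentFinset, K.verts.ncard := by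
  classical
  simp_rw [← card_vertexFinset]
  rw [vertexFinset_eq_biUnion, Finset.card_biUnion H.pairwiseDisjoint_vertexFinset]

theorem ncard_edgeSet_eq_sum [Finite V] (H : G.Subgraph) :
    H.edgeSet.ncard = ∑ K ∈ H.componentFinset, K.edgeSet.ncard := by
  classical
  have hU : H.edgeSet = ⋃ K ∈ H.components, K.edgeSet := by
    ext e
    induction e with
    | _ x y =>
    simp only [Set.mem_iUnion, exists_prop]
    refine ⟨fun h => ?_, fun ⟨K, hK, h⟩ => (le_of_mem_components hK).2 h⟩
    obtain ⟨K, hK, hxK⟩ := exists_mem_components h.fst_mem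
    exact ⟨K, hK, adj_of_mem_components hK hxK h⟩
  have hE : ∀ K : G.Subgraph, K.edgeSet.ncard = (Set.toFinite K.edgeSet).toFinset.card :=
    fun K => Set.ncard_eq_toFinset_card _
  simp_rw [hE]
  rw [← Finset.card_biUnion]
  · congr 1
    ext e
    simp [hU, mem_componentFinset]
  · intro K hK K' hK' hne
    refine Finset.disjoint_left.2 fun e he he' => hne ?_
    simp only [Set.Finite.mem_toFinset] at he he'
    induction e with
    | _ x y =>
    exact eq_of_mem_components (mem_componentFinset.1 hK) (mem_componentFinset.1 hK')
      (Subgraph.mem_edgeSet.1 he).fst_mem (Subgraph.mem_edgeSet.1 he').fst_mem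

theorem numComponents_eq_card [Finite V] (H : G.Subgraph) :
    H.numComponents = H.componentFinset.card := by
  rw [numComponents_eq_ncard, componentFinset, Set.ncard_eq_toFinset_card]

theorem rank_eq_sum [Finite V] (H : G.Subgraph) :
    H.rank = ∑ K ∈ H.componentFinset, ((K.verts.ncard : ℤ) - 1) := by
  rw [rank, ncard_verts_eq_sum, numComponents_eq_card]
  simp

theorem corank_eq_sum [Finite V] (H : G.Subgraph) :
    H.corank = ∑ K ∈ H.componentFinset, ((K.edgeSet.ncard : ℤ) - K.verts.ncard + 1) := by
  rw [corank, ncard_verts_eq_sum, ncard_edgeSet_eq_sum, numComponents_eq_card]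
  simp [Finset.sum_add_distrib]

end SimpleGraph.Subgraph

/-! ### The subgraph traced by a permutation. -/

namespace SimpleGraph

variable {V : Type*}

/-- The subgraph of `G` formed by the points moved by a permutation `σ` and by the edges that join
a point to its image. -/
def permSubgraph (G : SimpleGraph V) (σ : Equiv.Perm V) : G.Subgraph where
  verts := {v | σ v ≠ v}
  Adj u v := G.Adj u v ∧ (σ u = v ∨ σ v = u)
  adj_sub h := h.1
  edge_vert := by
    rintro u v ⟨h, h' | h'⟩
    · exact fun e => h.ne (e.symm.trans h')
    · exact fun e => h.ne (σ.injective (e.trans h'.symm))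
  symm := ⟨fun _ _ h => ⟨h.1.symm, h.2.symm⟩⟩

variable {G : SimpleGraph V}

theorem mem_permSubgraph_verts {σ : Equiv.Perm V} {v : V} :
    v ∈ (G.permSubgraph σ).verts ↔ σ v ≠ v := Iff.rfl

theorem permSubgraph_adj {σ : Equiv.Perm V} {u v : V} :
    (G.permSubgraph σ).Adj u v ↔ G.Adj u v ∧ (σ u = v ∨ σ v = u) := Iff.rfl

/-- The permutation moves every point either to itself or to a neighbour. -/
def IsPermAlong (G : SimpleGraph V) (σ : Equiv.Perm V) : Prop :=
  ∀ v, σ v ≠ v → G.Adj v (σ v)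

theorem permSubgraph_inv (σ : Equiv.Perm V) : G.permSubgraph σ⁻¹ = G.permSubgraph σ := by
  refine Subgraph.ext ?_ ?_
  · ext v
    simp only [mem_permSubgraph_verts, ne_eq, Equiv.Perm.inv_eq_iff_eq]
    exact not_congr eq_comm
  · funext u v
    simp only [permSubgraph_adj, Equiv.Perm.inv_eq_iff_eq]
    refine propext (and_congr_right fun _ => ?_)
    rw [or_comm, eq_comm (a := u), eq_comm (a := v)]

theorem IsPermAlong.inv {σ : Equiv.Perm V} (h : G.IsPermAlong σ) : G.IsPermAlong σ⁻¹ := by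
  intro v hv
  have := h (σ⁻¹ v) (by simpa using fun e => hv e.symm)
  simpa using this.symm

theorem permSubgraph_adj_apply {σ : Equiv.Perm V} (h : G.IsPermAlong σ) {v : V} (hv : σ v ≠ v) :
    (G.permSubgraph σ).Adj v (σ v) := ⟨h v hv, Or.inl rfl⟩

theorem connected_permSubgraph {c : Equiv.Perm V} [Finite V] (hc : c.IsCycle)
    (h : G.IsPermAlong c) : (G.permSubgraph c).Connected := by
  obtain ⟨x, hx, hxy⟩ := hc
  have hmv : ∀ n : ℕ, c ((c ^ n) x) ≠ (c ^ n) x := by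
    intro n e
    rw [← Equiv.Perm.mul_apply, ← pow_succ', pow_succ, Equiv.Perm.mul_apply] at e
    exact hx ((c ^ n).injective e)
  have reach : ∀ n : ℕ, (G.permSubgraph c).coe.Reachable ⟨x, hx⟩ ⟨(c ^ n) x, hmv n⟩ := by
    intro n
    induction n with
    | zero => exact SimpleGraph.Reachable.refl _
    | succ n ih =>
      refine ih.trans (SimpleGraph.Adj.reachable ?_)
      rw [Subgraph.coe_adj]
      simp only [pow_succ', Equiv.Perm.mul_apply]
      exact permSubgraph_adj_apply h (hmv n)
  have all : ∀ y : (G.permSubgraph c).verts, (G.permSubgraph c).coe.Reachable ⟨x, hx⟩ y := by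
    rintro ⟨y, hy⟩
    obtain ⟨n, -, rfl⟩ := (hxy hy).exists_pow_eq'
    exact reach n
  rw [Subgraph.connected_iff]
  exact ⟨⟨fun a b => (all a).symm.trans (all b)⟩, ⟨x, hx⟩⟩

theorem left_eq_of_pair_eq {a b y : V} (h : ({a, y} : Set V) = {b, y}) : a = b := by
  have h1 : a ∈ ({b, y} : Set V) := h ▸ Set.mem_insert _ _
  have h2 : b ∈ ({a, y} : Set V) := h ▸ Set.mem_insert _ _
  simp only [Set.mem_insert_iff, Set.mem_singleton_iff] at h1 h2
  rcases h1 with h1 | h1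
  · exact h1
  · rcases h2 with h2 | h2
    · exact h2.symm
    · exact h1.trans h2.symm

/-- The neighbours are the successor and the predecessor, which coincide when `v` lies on a 2-cycle
of `σ`. -/
theorem neighborSet_permSubgraph {σ : Equiv.Perm V} (h : G.IsPermAlong σ) {v : V} (hv : σ v ≠ v) :
    (G.permSubgraph σ).neighborSet v = {σ v, σ⁻¹ v} := by
  ext u
  simp only [Subgraph.mem_neighborSet, permSubgraph_adj, Set.mem_insert_iff, Set.mem_singleton_iff,
    Equiv.Perm.eq_inv_iff_eq]
  constructor
  · rintro ⟨-, h' | h'⟩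
    · exact Or.inl h'.symm
    · exact Or.inr h'
  · rintro (rfl | rfl)
    · exact ⟨h _ hv, Or.inl rfl⟩
    · exact ⟨(h u fun e => hv (by rw [e, e])).symm, Or.inr rfl⟩

/-- If `c` and `d` agree at `y`, then `c y` has predecessor `y` under both; as its neighbour set is
the same for both, its successors agree too. Agreement thus spreads along the orbit of `x`, which is
all that `c` moves. -/
theorem eq_of_permSubgraph_eq_of_apply_eq [Finite V] {c d : Equiv.Perm V} (hc : c.IsCycle)
    (hc' : G.IsPermAlong c) (hd' : G.IsPermAlong d)
    (h : G.permSubgraph c = G.permSubgraph d) {x : V} (hx : c x ≠ x) (hcd : c x = d x) : c = d := by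
  have hv : ∀ v, c v ≠ v ↔ d v ≠ v := fun v => by
    rw [← mem_permSubgraph_verts (G := G), h, mem_permSubgraph_verts]
  have step : ∀ y, c y ≠ y → c y = d y → c (c y) = d (c y) := by
    intro y hy hyd
    have h1 : c (c y) ≠ c y := fun e => hy (c.injective e)
    have e1 := neighborSet_permSubgraph hc' h1
    have h2 : d⁻¹ (c y) = y := by rw [Equiv.Perm.inv_eq_iff_eq, hyd]
    have h3 : c⁻¹ (c y) = y := by rw [Equiv.Perm.inv_eq_iff_eq]
    rw [h, neighborSet_permSubgraph hd' ((hv _).1 h1), h2, h3] at e1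
    exact (left_eq_of_pair_eq e1).symm
  have hpow : ∀ n : ℕ, c ((c ^ n) x) ≠ (c ^ n) x ∧ c ((c ^ n) x) = d ((c ^ n) x) := by
    intro n
    induction n with
    | zero => exact ⟨hx, hcd⟩
    | succ n ih =>
      rw [pow_succ', Equiv.Perm.mul_apply]
      exact ⟨fun e => ih.1 (c.injective e), step _ ih.1 ih.2⟩
  ext y
  by_cases hy : c y = y
  · rw [hy, eq_comm]
    by_contra hne
    exact (hv y).2 hne hy
  · obtain ⟨n, -, rfl⟩ := (hc.sameCycle hx hy).exists_pow_eq'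
    exact (hpow n).2

/-- A cycle has only two orientations: `c x` is a neighbour of `x`, hence its successor or its
predecessor under `d`. -/
theorem eq_or_eq_inv_of_permSubgraph_eq [Finite V] {c d : Equiv.Perm V} (hc : c.IsCycle)
    (hc' : G.IsPermAlong c) (hd' : G.IsPermAlong d)
    (h : G.permSubgraph d = G.permSubgraph c) : d = c ∨ d = c⁻¹ := by
  obtain ⟨x, hx, -⟩ := id hc
  have hm : c x ∈ (G.permSubgraph d).neighborSet x := by
    rw [h]; exact permSubgraph_adj_apply hc' hx
  have hdx : d x ≠ x := by rwa [← mem_permSubgraph_verts (G := G), h]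
  rw [neighborSet_permSubgraph hd' hdx] at hm
  rcases hm with hm | hm
  · exact Or.inl (eq_of_permSubgraph_eq_of_apply_eq hc hc' hd' h.symm hx hm).symm
  · refine Or.inr ?_
    rw [Set.mem_singleton_iff] at hm
    have := eq_of_permSubgraph_eq_of_apply_eq hc hc' hd'.inv
      (h.symm.trans (permSubgraph_inv d).symm) hx hm
    rw [this, inv_inv]

/-! ### Cycles of the graph versus cyclic permutations. -/

theorem walk_toSubgraph_eq_permSubgraph {c : Equiv.Perm V} {u : V}
    (w : G.Walk u u) (hw : ∀ d ∈ w.darts, c d.fst = d.snd)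
    (hs : ∀ v, v ∈ w.support.dropLast ↔ c v ≠ v) (hu : u ∈ w.support.dropLast) :
    w.toSubgraph = G.permSubgraph c := by
  refine Subgraph.ext ?_ ?_
  · ext v
    have hmem : v ∈ w.support ↔ v ∈ w.support.dropLast ∨ v = u := by
      conv_lhs => rw [← w.dropLast_support_concat]
      rw [List.mem_append, List.mem_singleton]
    rw [Walk.mem_verts_toSubgraph, mem_permSubgraph_verts, ← hs, hmem]
    exact ⟨fun h => h.elim id fun e => e ▸ hu, Or.inl⟩
  · have key : ∀ x y, G.Adj x y → c x = y → w.toSubgraph.Adj x y := by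
      intro x y hxy e
      have hx : x ∈ w.support.dropLast := (hs x).2 fun e' => hxy.ne (e'.symm.trans e)
      rw [← Walk.map_fst_darts, List.mem_map] at hx
      obtain ⟨d, hd, rfl⟩ := hx
      rw [Walk.adj_toSubgraph_iff_mem_edges, ← e, hw d hd]
      exact List.mem_map_of_mem hd
    funext x y
    refine propext ⟨fun h => ?_, ?_⟩
    · refine ⟨h.adj_sub, ?_⟩
      rw [Walk.adj_toSubgraph_iff_mem_edges, Walk.edges, List.mem_map] at h
      obtain ⟨d, hd, e⟩ := h
      have := hw d hd
      have e' : s(d.fst, d.snd) = s(x, y) := e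
      rw [Sym2.eq_iff] at e'
      rcases e' with ⟨e1, e2⟩ | ⟨e1, e2⟩
      · exact Or.inl (by rwa [e1, e2] at this)
      · exact Or.inr (by rwa [e1, e2] at this)
    · rintro ⟨h, e | e⟩
      · exact key x y h e
      · exact (key y x h.symm e).symm

theorem exists_walk_of_pow_apply_eq {c : Equiv.Perm V} (hc' : G.IsPermAlong c) (n : ℕ) :
    ∀ x y : V, c x ≠ x → (c ^ n) x = y → ∃ w : G.Walk x y,
      w.support = (List.range (n + 1)).map (fun i => (c ^ i) x) ∧
        ∀ d ∈ w.darts, c d.fst = d.snd := by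
  induction n with
  | zero =>
    intro x y _ hy
    obtain rfl : x = y := hy
    exact ⟨Walk.nil, by simp, by simp⟩
  | succ n ih =>
    intro x y hx hy
    obtain ⟨w, hw, hd⟩ := ih (c x) y (fun e => hx (c.injective e))
      (by rw [← hy, pow_succ, Equiv.Perm.mul_apply])
    refine ⟨Walk.cons (hc' x hx) w, ?_, ?_⟩
    · rw [Walk.support_cons, hw, List.range_succ_eq_map (n := n + 1), List.map_cons, List.map_map]
      simp [Function.comp_def, pow_succ]
    · intro d hd'
      rw [Walk.darts_cons, List.mem_cons] at hd'
      rcases hd' with rfl | hd'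
      · rfl
      · exact hd d hd'

theorem exists_isCycle_of_perm [Fintype V] [DecidableEq V] {c : Equiv.Perm V} (hc : c.IsCycle)
    (hc' : G.IsPermAlong c) (h3 : 3 ≤ c.support.card) :
    (G.permSubgraph c).IsCycleSubgraph := by
  obtain ⟨x, hx, hxy⟩ := id hc
  have hinj : ∀ i < c.support.card, ∀ j < c.support.card, (c ^ i) x = (c ^ j) x → i = j := by
    have key : ∀ i j, i ≤ j → j < c.support.card → (c ^ i) x = (c ^ j) x → i = j := by
      intro i j hij hj e
      obtain ⟨k, rfl⟩ := Nat.exists_eq_add_of_le hij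
      rw [pow_add, Equiv.Perm.mul_apply, (c ^ i).injective.eq_iff] at e
      rcases Nat.eq_zero_or_pos k with rfl | hk
      · rfl
      · exfalso
        -- A positive power of a cycle below its order moves every point that the cycle moves, so it
        -- cannot fix `x`.
        have hs := hc.support_pow_of_pos_of_lt_orderOf hk (by rw [hc.orderOf]; omega)
        have : x ∈ (c ^ k).support := by rw [hs]; simpa using hx
        exact Equiv.Perm.mem_support.1 this e.symm
    intro i hi j hj e
    rcases le_total i j with h | h
    · exact key i j h hj e
    · exact (key j i h hi e.symm).symm
  obtain ⟨m, hm⟩ : ∃ m, c.support.card = m + 1 := ⟨c.support.card - 1, by omega⟩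
  have hpow : (c ^ c.support.card) x = x := by rw [← hc.orderOf, pow_orderOf_eq_one]; rfl
  obtain ⟨w, hw, hd⟩ := exists_walk_of_pow_apply_eq hc' _ x x hx hpow
  have hdrop : w.support.dropLast = (List.range c.support.card).map (fun i => (c ^ i) x) := by
    rw [hw, List.range_succ, List.map_append, List.map_singleton, List.dropLast_concat]
  have hnd : w.support.dropLast.Nodup := by
    rw [hdrop]
    refine (List.nodup_range).map_on ?_
    intro i hi j hj e
    exact hinj i (List.mem_range.1 hi) j (List.mem_range.1 hj) e
  have hlen : w.length = c.support.card := by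
    have := w.length_support
    rw [hw] at this
    simpa using this.symm
  have hcyc : w.IsCycle := by
    rw [Walk.isCycle_iff_isPath_tail_and_le_length]
    refine ⟨?_, by omega⟩
    apply Walk.IsPath.mk'
    have hnn : ¬ w.Nil := by rw [← Walk.length_eq_zero_iff]; omega
    rw [w.support_tail_of_not_nil hnn]
    exact w.tail_support_perm_dropLast_support.nodup_iff.2 hnd
  refine ⟨x, w, hcyc, walk_toSubgraph_eq_permSubgraph w hd (fun v => ?_) ?_⟩
  · rw [hdrop]
    simp only [List.mem_map, List.mem_range]
    constructor
    · rintro ⟨i, -, rfl⟩ e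
      rw [← Equiv.Perm.mul_apply, ← pow_succ', pow_succ, Equiv.Perm.mul_apply] at e
      exact hx ((c ^ i).injective e)
    · intro hv
      obtain ⟨i, hi, e⟩ := (hxy hv).exists_pow_eq'
      exact ⟨i, hc.orderOf ▸ hi, e⟩
  · rw [hdrop]
    simp only [List.mem_map, List.mem_range]
    exact ⟨0, by omega, rfl⟩

/-- The permutation is `List.formPerm` of the support without its last entry, which only repeats the
base point. -/
theorem Walk.IsCycle.exists_perm [DecidableEq V] [Fintype V] {u : V} {w : G.Walk u u}
    (hw : w.IsCycle) :
    ∃ c : Equiv.Perm V, c.IsCycle ∧ G.IsPermAlong c ∧ w.toSubgraph = G.permSubgraph c ∧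
      (∀ d ∈ w.darts, c d.fst = d.snd) ∧ c.support = w.support.dropLast.toFinset := by
  have hnd := hw.nodup_dropLast_support
  have hlen : w.support.dropLast.length = w.length := by simp
  have h3 := hw.three_le_length
  have hne : ∀ x : V, w.support.dropLast ≠ [x] := fun x e => by
    rw [e] at hlen; simp at hlen; omega
  have hd : ∀ d ∈ w.darts, w.support.dropLast.formPerm d.fst = d.snd := by
    intro d hd
    obtain ⟨i, hi, rfl⟩ := List.getElem_of_mem hd
    have hi' : i < w.length := by simpa using hi
    rw [w.fst_darts_getElem (by simpa using hi), List.formPerm_apply_getElem _ hnd]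
    rw [w.snd_darts_getElem (by simpa using hi)]
    simp only [List.getElem_dropLast, hlen, List.getElem_tail]
    rcases Nat.lt_or_ge (i + 1) w.length with h | h
    · simp only [Nat.mod_eq_of_lt h]
    -- The last dart wraps around: its end is the base point, at index `0`.
    · have : i + 1 = w.length := by omega
      simp only [this, Nat.mod_self]
      simp
  have hs : ∀ v, v ∈ w.support.dropLast ↔ w.support.dropLast.formPerm v ≠ v := by
    intro v
    rw [← Equiv.Perm.mem_support, List.support_formPerm_of_nodup _ hnd hne, List.mem_toFinset]
  have hP : G.IsPermAlong w.support.dropLast.formPerm := by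
    intro v hv
    rw [← hs, ← Walk.map_fst_darts, List.mem_map] at hv
    obtain ⟨d, hd', rfl⟩ := hv
    rw [hd d hd']
    exact d.adj
  have hu : u ∈ w.support.dropLast := by
    refine w.tail_support_perm_dropLast_support.mem_iff.1 ?_
    exact Walk.end_mem_tail_support hw.not_nil
  exact ⟨_, List.isCycle_formPerm hnd (by omega), hP, walk_toSubgraph_eq_permSubgraph w hd hs hu,
    hd, List.support_formPerm_of_nodup _ hnd hne⟩

theorem isPermAlong_swap [DecidableEq V] {u v : V} (h : G.Adj u v) :
    G.IsPermAlong (Equiv.swap u v) := by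
  intro x hx
  rcases eq_or_ne x u with rfl | hu
  · simpa using h
  · rcases eq_or_ne x v with rfl | hv
    · simpa using h.symm
    · exact absurd (Equiv.swap_apply_of_ne_of_ne hu hv) hx

theorem permSubgraph_swap [DecidableEq V] {u v : V} (h : G.Adj u v) :
    G.permSubgraph (Equiv.swap u v) = G.subgraphOfAdj h := by
  have hn := h.ne
  refine Subgraph.ext ?_ ?_
  · ext x
    rw [mem_permSubgraph_verts, Equiv.swap_apply_ne_self_iff]
    simp [hn]
  · funext x y
    rw [permSubgraph_adj, subgraphOfAdj_adj]
    refine propext ⟨?_, ?_⟩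
    · rintro ⟨hxy, e⟩
      have hx := hxy.ne
      rw [Equiv.swap_apply_def, Equiv.swap_apply_def] at e
      rw [Sym2.eq_iff]
      grind
    · intro e
      rw [Sym2.eq_iff] at e
      rcases e with ⟨rfl, rfl⟩ | ⟨rfl, rfl⟩
      · exact ⟨h, by simp⟩
      · exact ⟨h.symm, by simp⟩

theorem permSubgraph_isSingleEdge_or_isCycleSubgraph [Fintype V] [DecidableEq V]
    {c : Equiv.Perm V} (hc : c.IsCycle) (hc' : G.IsPermAlong c) :
    (G.permSubgraph c).IsSingleEdge ∨ (G.permSubgraph c).IsCycleSubgraph := by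
  rcases hc.two_le_card_support.eq_or_lt with h | h
  · obtain ⟨x, y, hxy, rfl⟩ := Equiv.Perm.card_support_eq_two.1 h.symm
    have hadj : G.Adj x y := by
      simpa using hc' x (by simpa using hxy.symm)
    exact Or.inl ⟨x, y, hadj, permSubgraph_swap hadj⟩
  · exact Or.inr (exists_isCycle_of_perm hc hc' h)

end SimpleGraph

/-! ### Disjoint cycles of a permutation as components of its subgraph. -/

open SimpleGraph SimpleGraph.Subgraph

namespace SimpleGraph

variable {V : Type*} {G : SimpleGraph V}

theorem Walk.IsCycle.ncard_edgeSet_toSubgraph {u : V} {w : G.Walk u u} (hw : w.IsCycle) :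
    w.toSubgraph.edgeSet.ncard = w.length := by
  classical
  have : w.toSubgraph.edgeSet = (w.edges.toFinset : Set (Sym2 V)) := by
    ext e
    rw [Walk.mem_edges_toSubgraph]
    simp
  rw [this, Set.ncard_coe_finset, List.toFinset_card_of_nodup hw.edges_nodup, Walk.length_edges]

theorem Subgraph.IsSingleEdge.ncard_verts {K : G.Subgraph} (hK : K.IsSingleEdge) :
    K.verts.ncard = 2 := by
  obtain ⟨u, v, h, rfl⟩ := hK
  exact Set.ncard_pair h.ne

theorem Subgraph.IsSingleEdge.ncard_edgeSet {K : G.Subgraph} (hK : K.IsSingleEdge) :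
    K.edgeSet.ncard = 1 := by
  obtain ⟨u, v, h, rfl⟩ := hK
  rw [edgeSet_subgraphOfAdj, Set.ncard_singleton]

variable [Fintype V] [DecidableEq V]

theorem IsPermAlong.of_mem_cycleFactorsFinset {σ c : Equiv.Perm V} (h : G.IsPermAlong σ)
    (hc : c ∈ σ.cycleFactorsFinset) : G.IsPermAlong c := by
  intro v hv
  have e := (Equiv.Perm.mem_cycleFactorsFinset_iff.1 hc).2 v (Equiv.Perm.mem_support.2 hv)
  rw [e] at hv ⊢
  exact h v hv

theorem isPermAlong_of_forall_mem_cycleFactorsFinset {σ : Equiv.Perm V}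
    (h : ∀ c ∈ σ.cycleFactorsFinset, G.IsPermAlong c) : G.IsPermAlong σ := by
  intro v hv
  obtain ⟨c, hc, hvc⟩ := Equiv.Perm.mem_support_iff_mem_support_of_mem_cycleFactorsFinset.1
    (Equiv.Perm.mem_support.2 hv)
  rw [← (Equiv.Perm.mem_cycleFactorsFinset_iff.1 hc).2 v hvc]
  exact h c hc v (Equiv.Perm.mem_support.1 hvc)

theorem permSubgraph_mem_components {σ c : Equiv.Perm V} (h : G.IsPermAlong σ)
    (hc : c ∈ σ.cycleFactorsFinset) : G.permSubgraph c ∈ (G.permSubgraph σ).components := by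
  obtain ⟨hcyc, hcσ⟩ := Equiv.Perm.mem_cycleFactorsFinset_iff.1 hc
  have hmv : ∀ v, c v ≠ v → c v = σ v := fun v hv => hcσ v (Equiv.Perm.mem_support.2 hv)
  refine mem_components_of_closed (connected_permSubgraph hcyc (h.of_mem_cycleFactorsFinset hc))
    ⟨fun v hv => ?_, fun u v huv => ?_⟩ ?_
  · rw [mem_permSubgraph_verts] at hv ⊢
    rwa [← hmv v hv]
  · obtain ⟨ha, e | e⟩ := huv
    · exact ⟨ha, Or.inl (by rw [← hmv u fun e' => ha.ne (e'.symm.trans e), e])⟩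
    · exact ⟨ha, Or.inr (by rw [← hmv v fun e' => ha.ne' (e'.symm.trans e), e])⟩
  · rintro u hu v ⟨ha, e | e⟩
    · exact ⟨ha, Or.inl (by rw [hmv u hu, e])⟩
    -- The edge reaches `u` from its predecessor under `σ`; `c` and `σ` agree at `c⁻¹ u`, so
    -- injectivity of `σ` identifies that predecessor with `c⁻¹ u`.
    · refine ⟨ha, Or.inr ?_⟩
      have h1 : c (c⁻¹ u) = u := c.apply_symm_apply u
      have h2 : c (c⁻¹ u) ≠ c⁻¹ u := fun e' => hu (by
        have := congrArg c e'
        rwa [h1] at this)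
      have h3 : v = c⁻¹ u := σ.injective (by rw [e, ← hmv _ h2, h1])
      rw [h3, h1]

theorem mem_components_permSubgraph_iff {σ : Equiv.Perm V} (h : G.IsPermAlong σ)
    {K : G.Subgraph} : K ∈ (G.permSubgraph σ).components ↔
      ∃ c ∈ σ.cycleFactorsFinset, G.permSubgraph c = K := by
  constructor
  · intro hK
    obtain ⟨u, hu⟩ := nonempty_of_mem_components hK
    have huσ : σ u ≠ u := (le_of_mem_components hK).1 hu
    obtain ⟨c, hc, huc⟩ := Equiv.Perm.mem_support_iff_mem_support_of_mem_cycleFactorsFinset.1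
      (Equiv.Perm.mem_support.2 huσ)
    exact ⟨c, hc, eq_of_mem_components (permSubgraph_mem_components h hc) hK
      (u := u) (Equiv.Perm.mem_support.1 huc) hu⟩
  · rintro ⟨c, hc, rfl⟩
    exact permSubgraph_mem_components h hc

open scoped Classical in
/-- The cyclic permutations that run once around `K`. -/
noncomputable def cyclesOver (K : G.Subgraph) : Finset (Equiv.Perm V) :=
  {c | c.IsCycle ∧ G.IsPermAlong c ∧ G.permSubgraph c = K}

theorem mem_cyclesOver {K : G.Subgraph} {c : Equiv.Perm V} :
    c ∈ cyclesOver K ↔ c.IsCycle ∧ G.IsPermAlong c ∧ G.permSubgraph c = K := by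
  simp [cyclesOver]

/-- Distinct components share no vertex, so cycles chosen over them are disjoint and are the cycle
factors of one permutation. -/
theorem exists_perm_of_cyclesOver (H : G.Subgraph) (p : H.componentFinset → Equiv.Perm V)
    (hp : ∀ K, p K ∈ cyclesOver K.1) :
    ∃ σ : Equiv.Perm V, σ.cycleFactorsFinset = Finset.univ.image p := by
  have hd : ((Finset.univ.image p : Finset (Equiv.Perm V)) : Set (Equiv.Perm V)).Pairwise
      Equiv.Perm.Disjoint := by
    intro c hc d hd hne x
    simp only [Finset.coe_image, Finset.coe_univ, Set.image_univ, Set.mem_range] at hc hd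
    obtain ⟨K, rfl⟩ := hc
    obtain ⟨K', rfl⟩ := hd
    by_contra hcon
    rw [not_or] at hcon
    refine hne (congrArg p (Subtype.ext ?_))
    refine eq_of_mem_components (mem_componentFinset.1 K.2) (mem_componentFinset.1 K'.2)
      (u := x) ?_ ?_
    · rw [← (mem_cyclesOver.1 (hp K)).2.2]; exact hcon.1
    · rw [← (mem_cyclesOver.1 (hp K')).2.2]; exact hcon.2
  refine ⟨_, Equiv.Perm.cycleFactorsFinset_eq_finset.2 ⟨fun f hf => ?_, hd, rfl⟩⟩
  rw [Finset.mem_image] at hf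
  obtain ⟨K, -, rfl⟩ := hf
  exact (mem_cyclesOver.1 (hp K)).1

open scoped Classical in
/-- A weight on permutations that is multiplicative over the disjoint cycles, summed over the
permutations with a given subgraph, factors over the components of that subgraph. -/
theorem sum_eq_prod_sum_cyclesOver {R : Type*} [CommSemiring R] (W : Equiv.Perm V → R)
    (hW : ∀ σ, W σ = ∏ c ∈ σ.cycleFactorsFinset, W c) (H : G.Subgraph) :
    ∑ σ : Equiv.Perm V with G.IsPermAlong σ ∧ G.permSubgraph σ = H, W σ =
      ∏ K ∈ H.componentFinset, ∑ c ∈ cyclesOver K, W c := by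
  -- Distributing the product gives a sum over choices `p` of one cyclic permutation per component;
  -- the bijection sends `p` to the permutation with these cycle factors.
  rw [← Finset.prod_coe_sort, Finset.prod_univ_sum]
  symm
  have hp' : ∀ p ∈ Fintype.piFinset (fun K : H.componentFinset => cyclesOver K.1),
      ∀ K, p K ∈ cyclesOver K.1 := fun p hp => Fintype.mem_piFinset.1 hp
  have hsub : ∀ p ∈ Fintype.piFinset (fun K : H.componentFinset => cyclesOver K.1),
      ∀ K, G.permSubgraph (p K) = K.1 := fun p hp K => (mem_cyclesOver.1 (hp' p hp K)).2.2
  have hinj : ∀ p ∈ Fintype.piFinset (fun K : H.componentFinset => cyclesOver K.1),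
      Function.Injective p := by
    intro p hp K K' e
    exact Subtype.ext (by rw [← hsub p hp K, e, hsub p hp K'])
  refine Finset.sum_bij
    (fun p hp => (exists_perm_of_cyclesOver H p (hp' p hp)).choose) ?_ ?_ ?_ ?_
  · intro p hp
    have hσ := (exists_perm_of_cyclesOver H p (hp' p hp)).choose_spec
    generalize (exists_perm_of_cyclesOver H p (hp' p hp)).choose = σ at hσ
    have hal : G.IsPermAlong σ := isPermAlong_of_forall_mem_cycleFactorsFinset fun c hc => by
      rw [hσ, Finset.mem_image] at hc
      obtain ⟨K, -, rfl⟩ := hc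
      exact (mem_cyclesOver.1 (hp' p hp K)).2.1
    rw [Finset.mem_filter]
    refine ⟨Finset.mem_univ _, hal, eq_of_components_eq (Set.ext fun K => ?_)⟩
    rw [mem_components_permSubgraph_iff hal, hσ]
    constructor
    · rintro ⟨c, hc, rfl⟩
      obtain ⟨K, -, rfl⟩ := Finset.mem_image.1 hc
      rw [hsub p hp K]
      exact mem_componentFinset.1 K.2
    · intro hK
      exact ⟨p ⟨K, mem_componentFinset.2 hK⟩, Finset.mem_image_of_mem _ (Finset.mem_univ _),
        hsub p hp _⟩
  · intro p hp q hq e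
    have hσ := (exists_perm_of_cyclesOver H p (hp' p hp)).choose_spec
    have hτ := (exists_perm_of_cyclesOver H q (hp' q hq)).choose_spec
    rw [e, hτ] at hσ
    funext K
    have : p K ∈ Finset.univ.image q := hσ ▸ Finset.mem_image_of_mem _ (Finset.mem_univ _)
    obtain ⟨K', -, e'⟩ := Finset.mem_image.1 this
    have : K' = K := Subtype.ext (by rw [← hsub q hq K', e', hsub p hp K])
    rw [← e', this]
  · intro σ hσ
    rw [Finset.mem_filter] at hσ
    obtain ⟨-, hal, rfl⟩ := hσ
    have hex : ∀ K : (G.permSubgraph σ).componentFinset,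
        ∃ c ∈ σ.cycleFactorsFinset, G.permSubgraph c = K.1 := fun K =>
      (mem_components_permSubgraph_iff hal).1 (mem_componentFinset.1 K.2)
    choose p hpm hpK using hex
    have hp : p ∈ Fintype.piFinset
        (fun K : (G.permSubgraph σ).componentFinset => cyclesOver K.1) :=
      Fintype.mem_piFinset.2 fun K => mem_cyclesOver.2
        ⟨(Equiv.Perm.mem_cycleFactorsFinset_iff.1 (hpm K)).1,
          hal.of_mem_cycleFactorsFinset (hpm K), hpK K⟩
    refine ⟨p, hp, Equiv.Perm.cycleFactorsFinset_injective ?_⟩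
    rw [(exists_perm_of_cyclesOver _ p (hp' p hp)).choose_spec]
    ext c
    rw [Finset.mem_image]
    constructor
    · rintro ⟨K, -, rfl⟩
      exact hpm K
    · intro hc
      refine ⟨⟨G.permSubgraph c, mem_componentFinset.2 (permSubgraph_mem_components hal hc)⟩,
        Finset.mem_univ _, ?_⟩
      -- Two different cycle factors of `σ` would be disjoint, yet both move the vertices of the
      -- same subgraph.
      by_contra hne
      obtain ⟨x, hx, -⟩ := (Equiv.Perm.mem_cycleFactorsFinset_iff.1 hc).1
      have hx' : x ∈ (G.permSubgraph c).verts := hx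
      rcases Equiv.Perm.cycleFactorsFinset_pairwise_disjoint σ (hpm _) hc hne x with h | h
      · have e := hpK ⟨G.permSubgraph c,
          mem_componentFinset.2 (permSubgraph_mem_components hal hc)⟩
        exact (e ▸ hx' : x ∈ (G.permSubgraph (p _)).verts) h
      · exact hx h
  · intro p hp
    have hσ := (exists_perm_of_cyclesOver H p (hp' p hp)).choose_spec
    rw [hW (exists_perm_of_cyclesOver H p (hp' p hp)).choose, hσ,
      Finset.prod_image (hinj p hp).injOn]

theorem cyclesOver_subgraphOfAdj {u v : V} (h : G.Adj u v) :
    cyclesOver (G.subgraphOfAdj h) = {Equiv.swap u v} := by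
  have hs := Equiv.Perm.isCycle_swap h.ne
  have ha := isPermAlong_swap h
  ext c
  rw [mem_cyclesOver, Finset.mem_singleton, ← permSubgraph_swap h]
  refine ⟨fun ⟨_, h2, h3⟩ => ?_, fun e => by rw [e]; exact ⟨hs, ha, rfl⟩⟩
  rcases eq_or_eq_inv_of_permSubgraph_eq hs ha h2 h3 with e | e
  · exact e
  · rw [e, Equiv.swap_inv]

theorem cyclesOver_permSubgraph {c : Equiv.Perm V} (hc : c.IsCycle) (hc' : G.IsPermAlong c) :
    cyclesOver (G.permSubgraph c) = {c, c⁻¹} := by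
  ext d
  rw [mem_cyclesOver, Finset.mem_insert, Finset.mem_singleton]
  refine ⟨fun ⟨_, h2, h3⟩ => eq_or_eq_inv_of_permSubgraph_eq hc hc' h2 h3, ?_⟩
  rintro (rfl | rfl)
  · exact ⟨hc, hc', rfl⟩
  · exact ⟨hc.inv, hc'.inv, permSubgraph_inv c⟩

theorem ncard_verts_permSubgraph (σ : Equiv.Perm V) :
    (G.permSubgraph σ).verts.ncard = σ.support.card := by
  rw [← Set.ncard_coe_finset]
  congr 1
  ext v
  simp [mem_permSubgraph_verts]

theorem vertexFinset_permSubgraph (σ : Equiv.Perm V) :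
    (G.permSubgraph σ).vertexFinset = σ.support := by
  ext v
  rw [mem_vertexFinset, mem_permSubgraph_verts, Equiv.Perm.mem_support]

theorem Walk.IsCycle.ncard_verts_toSubgraph {u : V} {w : G.Walk u u} (hw : w.IsCycle) :
    w.toSubgraph.verts.ncard = w.length := by
  obtain ⟨c, -, -, e, -, hs⟩ := hw.exists_perm
  rw [e, ncard_verts_permSubgraph, hs, List.toFinset_card_of_nodup hw.nodup_dropLast_support]
  simp

theorem Subgraph.IsSingleEdge.not_isCycleSubgraph {K : G.Subgraph} (hK : K.IsSingleEdge) :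
    ¬ K.IsCycleSubgraph := by
  rintro ⟨u, w, hw, rfl⟩
  have h1 := hK.ncard_verts
  have h2 := hw.three_le_length
  rw [hw.ncard_verts_toSubgraph] at h1
  omega

open scoped Classical in
-- Per component, `|E| - |V| + 1` is `1 - 2 + 1 = 0` for an edge and `1` for a cycle.
theorem Subgraph.IsElementary.corank_eq_card_cycles {H : G.Subgraph} (hH : H.IsElementary) :
    H.corank = H.cycles.card := by
  have hc : H.cycles = H.componentFinset.filter IsCycleSubgraph := by
    ext K
    simp [Subgraph.cycles, mem_componentFinset]
  rw [corank_eq_sum, hc, Finset.card_filter, Nat.cast_sum]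
  refine Finset.sum_congr rfl fun K hK => ?_
  rcases hH K (mem_componentFinset.1 hK) with h | h
  · rw [h.ncard_edgeSet, h.ncard_verts, if_neg h.not_isCycleSubgraph]
    norm_num
  · rw [if_pos h]
    obtain ⟨u, w, hw, rfl⟩ := h
    rw [hw.ncard_edgeSet_toSubgraph, hw.ncard_verts_toSubgraph]
    simp

theorem isElementary_permSubgraph {σ : Equiv.Perm V} (h : G.IsPermAlong σ) :
    (G.permSubgraph σ).IsElementary := by
  intro K hK
  obtain ⟨c, hc, rfl⟩ := (mem_components_permSubgraph_iff h).1 hK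
  exact permSubgraph_isSingleEdge_or_isCycleSubgraph
    (Equiv.Perm.mem_cycleFactorsFinset_iff.1 hc).1 (h.of_mem_cycleFactorsFinset hc)

end SimpleGraph

/-! ### Weights of permutations. -/

namespace GainGraph

variable {V : Type*} {G : SimpleGraph V} [DecidableRel G.Adj]

/-- The gain matrix: the Hermitian adjacency matrix with the gains as entries. -/
noncomputable def gainMatrix (Φ : GainGraph G) : Matrix V V ℂ := fun i j =>
  if h : G.Adj i j then (Φ.gain ⟨(i, j), h⟩ : ℂ) else 0

theorem gainMatrix_dart (Φ : GainGraph G) (d : G.Dart) :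
    Φ.gainMatrix d.fst d.snd = Φ.gain d := dif_pos d.adj

theorem gainMatrix_of_not_adj (Φ : GainGraph G) {i j : V} (h : ¬ G.Adj i j) :
    Φ.gainMatrix i j = 0 := dif_neg h

theorem gainMatrix_swap (Φ : GainGraph G) (i j : V) :
    Φ.gainMatrix j i = starRingEnd ℂ (Φ.gainMatrix i j) := by
  by_cases h : G.Adj i j
  · have h1 := Φ.gainMatrix_dart ⟨(i, j), h⟩
    have h2 := Φ.gainMatrix_dart ⟨(j, i), h.symm⟩
    have h3 : Φ.gain ⟨(j, i), h.symm⟩ = (Φ.gain ⟨(i, j), h⟩)⁻¹ := Φ.gain_symm ⟨(i, j), h⟩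
    rw [h3, Circle.coe_inv_eq_conj] at h2
    exact h2.trans (congrArg _ h1.symm)
  · rw [Φ.gainMatrix_of_not_adj h, Φ.gainMatrix_of_not_adj fun h' => h h'.symm, map_zero]

theorem gainMatrix_mul_swap (Φ : GainGraph G) {i j : V} (h : G.Adj i j) :
    Φ.gainMatrix i j * Φ.gainMatrix j i = 1 := by
  rw [gainMatrix_swap Φ i j, Φ.gainMatrix_dart ⟨(i, j), h⟩, Complex.mul_conj,
    Complex.normSq_eq_norm_sq]
  rw [Circle.norm_coe, one_pow, Complex.ofReal_one]

variable [Fintype V] [DecidableEq V]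

/-- The contribution of a permutation to the expansion of the normalized characteristic
polynomial: its signed gain divided by the degrees of the points that it moves. -/
noncomputable def permWeight (Φ : GainGraph G) (σ : Equiv.Perm V) : ℂ :=
  (Equiv.Perm.sign σ : ℤ) * ∏ i ∈ σ.support, (Φ.gainMatrix i (σ i) / G.degree i)

theorem permWeight_mul (Φ : GainGraph G) {σ τ : Equiv.Perm V} (h : σ.Disjoint τ) :
    Φ.permWeight (σ * τ) = Φ.permWeight σ * Φ.permWeight τ := by
  have h1 : ∀ i ∈ σ.support, (σ * τ) i = σ i := fun i hi => by
    rw [Equiv.Perm.mul_apply, (h i).resolve_left (Equiv.Perm.mem_support.1 hi)]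
  have h2 : ∀ i ∈ τ.support, (σ * τ) i = τ i := fun i hi => by
    rw [h.commute.eq, Equiv.Perm.mul_apply, (h i).resolve_right (Equiv.Perm.mem_support.1 hi)]
  rw [permWeight, h.support_mul, Finset.prod_union h.disjoint_support,
    Finset.prod_congr rfl fun i hi => by rw [h1 i hi],
    Finset.prod_congr (s₁ := τ.support) rfl fun i hi => by rw [h2 i hi]]
  simp only [permWeight, Equiv.Perm.sign_mul, Units.val_mul, Int.cast_mul]
  ring

theorem permWeight_eq_prod_cycleFactorsFinset (Φ : GainGraph G) (σ : Equiv.Perm V) :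
    Φ.permWeight σ = ∏ c ∈ σ.cycleFactorsFinset, Φ.permWeight c := by
  induction σ using Equiv.Perm.cycle_induction_on with
  | base_one => simp [permWeight]
  | base_cycles σ hσ => rw [hσ.cycleFactorsFinset_eq_singleton, Finset.prod_singleton]
  | induction_disjoint σ τ h _ ihσ ihτ =>
    rw [Φ.permWeight_mul h, h.cycleFactorsFinset_mul_eq_union,
      Finset.prod_union h.disjoint_cycleFactorsFinset, ← ihσ, ← ihτ]

theorem permWeight_eq_zero (Φ : GainGraph G) {σ : Equiv.Perm V} (h : ¬ G.IsPermAlong σ) :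
    Φ.permWeight σ = 0 := by
  simp only [IsPermAlong, not_forall] at h
  obtain ⟨v, hv, hna⟩ := h
  rw [permWeight, Finset.prod_eq_zero (Equiv.Perm.mem_support.2 hv), mul_zero]
  rw [Φ.gainMatrix_of_not_adj hna, zero_div]

theorem permWeight_swap (Φ : GainGraph G) {u v : V} (h : G.Adj u v) :
    Φ.permWeight (Equiv.swap u v) = -1 / (G.degree u * G.degree v) := by
  rw [permWeight, Equiv.Perm.support_swap h.ne, Finset.prod_pair h.ne, Equiv.Perm.sign_swap h.ne,
    Equiv.swap_apply_left, Equiv.swap_apply_right, div_mul_div_comm, Φ.gainMatrix_mul_swap h]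
  simp [neg_div]

/-- The gain matrix is Hermitian, while the sign, the support and the degrees do not change under
inversion. -/
theorem permWeight_inv (Φ : GainGraph G) (σ : Equiv.Perm V) :
    Φ.permWeight σ⁻¹ = starRingEnd ℂ (Φ.permWeight σ) := by
  rw [permWeight, permWeight, map_mul, map_prod, Equiv.Perm.sign_inv, Equiv.Perm.support_inv,
    Finset.prod_div_distrib]
  simp only [map_div₀, Finset.prod_div_distrib, Complex.conj_natCast]
  rw [map_intCast]
  congr 2
  refine Finset.prod_bij (fun i _ => σ⁻¹ i) (fun i hi => ?_) (fun i _ j _ e => σ⁻¹.injective e)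
    (fun j hj => ⟨σ j, Equiv.Perm.apply_mem_support.2 hj, σ.symm_apply_apply j⟩) fun i _ => ?_
  · rw [← Equiv.Perm.support_inv] at hi ⊢
    exact Equiv.Perm.apply_mem_support.2 hi
  · rw [gainMatrix_swap Φ (σ⁻¹ i) i]
    congr 2
    exact (σ.apply_symm_apply i).symm

theorem permWeight_of_isCycle_walk (Φ : GainGraph G) {u : V} {w : G.Walk u u} (hw : w.IsCycle)
    {c : Equiv.Perm V} (hd : ∀ d ∈ w.darts, c d.fst = d.snd)
    (hs : c.support = w.support.dropLast.toFinset) :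
    Φ.permWeight c = (Equiv.Perm.sign c : ℤ) *
      (Φ.walkGain w / ∏ i ∈ c.support, (G.degree i : ℂ)) := by
  rw [permWeight, Finset.prod_div_distrib]
  congr 2
  rw [hs, List.prod_toFinset _ hw.nodup_dropLast_support, ← Walk.map_fst_darts, List.map_map,
    walkGain]
  refine Eq.trans ?_ (map_list_prod Circle.coeHom _).symm
  rw [List.map_map]
  refine congrArg List.prod (List.map_congr_left fun d hd' => ?_)
  change Φ.gainMatrix d.fst (c d.fst) = (Φ.gain d : ℂ)
  rw [hd d hd', gainMatrix_dart]

open scoped Classical in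
/-- The total contribution of the cyclic permutations running around an edge or a cycle. -/
theorem sum_cyclesOver_permWeight (Φ : GainGraph G) {K : G.Subgraph}
    (hK : K.IsSingleEdge ∨ K.IsCycleSubgraph) :
    ∑ c ∈ cyclesOver K, Φ.permWeight c =
      (((-1 : ℝ) ^ ((K.verts.ncard : ℤ) - 1) *
        ((if K.IsCycleSubgraph then 2 * Φ.reCycleGain K else 1) /
          ∏ v ∈ K.vertexFinset, (G.degree v : ℝ)) : ℝ) : ℂ) := by
  rcases hK with hK | hK
  · rw [hK.ncard_verts, if_neg hK.not_isCycleSubgraph]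
    obtain ⟨u, v, h, rfl⟩ := hK
    rw [cyclesOver_subgraphOfAdj, Finset.sum_singleton, Φ.permWeight_swap h, ← permSubgraph_swap h,
      vertexFinset_permSubgraph, Equiv.Perm.support_swap h.ne, Finset.prod_pair h.ne]
    push_cast
    norm_num
    ring
  · rw [if_pos hK]
    obtain ⟨u, w, hw, rfl⟩ := hK
    rw [Φ.reCycleGain_eq w hw, hw.ncard_verts_toSubgraph]
    have hlen := hw.ncard_verts_toSubgraph
    have h3 := hw.three_le_length
    obtain ⟨c, hc, hc', he, hd, hs⟩ := hw.exists_perm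
    rw [he, ncard_verts_permSubgraph] at hlen
    rw [he, cyclesOver_permSubgraph hc hc', vertexFinset_permSubgraph]
    -- The order of `c` is the length of the cycle, at least three, so the two orientations are
    -- different.
    have hne : c ≠ c⁻¹ := by
      intro e
      have h2 : c ^ 2 = 1 := by rw [pow_two]; nth_rewrite 2 [e]; exact mul_inv_cancel c
      have := Nat.le_of_dvd (by norm_num) (orderOf_dvd_of_pow_eq_one h2)
      rw [hc.orderOf] at this
      omega
    -- A weight plus its conjugate is twice its real part.
    rw [Finset.sum_pair hne, Φ.permWeight_inv, Complex.add_conj]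
    congr 1
    have hsign : ((Equiv.Perm.sign c : ℤ) : ℝ) = (-1 : ℝ) ^ ((w.length : ℤ) - 1) := by
      rw [hc.sign, hlen, zpow_sub₀ (by norm_num), zpow_natCast]
      push_cast
      ring
    have hW : Φ.permWeight c = (((-1 : ℝ) ^ ((w.length : ℤ) - 1) *
        (∏ i ∈ c.support, (G.degree i : ℝ))⁻¹ : ℝ) : ℂ) * (Φ.walkGain w : ℂ) := by
      rw [Φ.permWeight_of_isCycle_walk hw hd hs, ← hsign]
      push_cast
      ring
    rw [hW, Complex.re_ofReal_mul]
    ring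

open scoped Classical in
/-- The total contribution of the permutations with a given elementary subgraph. -/
theorem sum_permWeight_of_isElementary (Φ : GainGraph G) {H : G.Subgraph} (hH : H.IsElementary) :
    ∑ σ : Equiv.Perm V with G.IsPermAlong σ ∧ G.permSubgraph σ = H, Φ.permWeight σ =
      (((-1 : ℝ) ^ H.rank * (2 : ℝ) ^ H.corank *
        ((∏ C ∈ H.cycles, Φ.reCycleGain C) / ∏ v ∈ H.vertexFinset, (G.degree v : ℝ)) : ℝ) : ℂ) := by
  have hcyc : H.cycles = H.componentFinset.filter IsCycleSubgraph := by
    ext K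
    simp [Subgraph.cycles, mem_componentFinset]
  have hrank : (-1 : ℝ) ^ H.rank =
      ∏ K ∈ H.componentFinset, (-1 : ℝ) ^ ((K.verts.ncard : ℤ) - 1) := by
    rw [rank_eq_sum]
    induction H.componentFinset using Finset.induction_on with
    | empty => simp
    | insert K s hK ih =>
      rw [Finset.sum_insert hK, Finset.prod_insert hK, zpow_add₀ (by norm_num), ih]
  rw [sum_eq_prod_sum_cyclesOver _ Φ.permWeight_eq_prod_cycleFactorsFinset,
    Finset.prod_congr rfl fun K hK =>
      Φ.sum_cyclesOver_permWeight (hH K (mem_componentFinset.1 hK)),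
    ← Complex.ofReal_prod, Finset.prod_mul_distrib, Finset.prod_div_distrib, ← hrank,
    ← prod_vertexFinset, ← Finset.prod_filter, ← hcyc, Finset.prod_mul_distrib,
    Finset.prod_const, hH.corank_eq_card_cycles, zpow_natCast]
  congr 1
  ring

/-- Permutations not along `G` have weight zero; the others are grouped by `permSubgraph`, which is
elementary with as many vertices as there are moved points. -/
theorem sum_permWeight_card_support (Φ : GainGraph G) (k : ℕ) :
    ∑ σ : Equiv.Perm V with σ.support.card = k, Φ.permWeight σ =
      ((∑ H ∈ G.elementarySubgraphs k,
          (-1 : ℝ) ^ H.rank * (2 : ℝ) ^ H.corank *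
            ((∏ C ∈ H.cycles, Φ.reCycleGain C) / ∏ v ∈ H.vertexFinset, (G.degree v : ℝ)) : ℝ) :
              ℂ) := by
  classical
  have hmem : ∀ H, H ∈ G.elementarySubgraphs k ↔ H.IsElementary ∧ H.verts.ncard = k := fun H => by
    simp [elementarySubgraphs]
  have hstep : ∑ σ : Equiv.Perm V with σ.support.card = k, Φ.permWeight σ =
      ∑ σ : Equiv.Perm V with G.IsPermAlong σ ∧ σ.support.card = k, Φ.permWeight σ := by
    refine (Finset.sum_subset (fun σ hσ => ?_) fun σ hσ hσ' => ?_).symm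
    · simp only [Finset.mem_filter, Finset.mem_univ, true_and] at hσ ⊢
      exact hσ.2
    · simp only [Finset.mem_filter, Finset.mem_univ, true_and] at hσ hσ'
      exact Φ.permWeight_eq_zero fun h => hσ' ⟨h, hσ⟩
  rw [hstep, ← Finset.sum_fiberwise_of_maps_to (t := G.elementarySubgraphs k)
    (g := G.permSubgraph), Complex.ofReal_sum]
  · refine Finset.sum_congr rfl fun H hH => ?_
    obtain ⟨hE, hk⟩ := (hmem H).1 hH
    rw [← Φ.sum_permWeight_of_isElementary hE, Finset.filter_filter]
    refine Finset.sum_congr (Finset.filter_congr fun σ _ => ?_) fun _ _ => rfl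
    refine ⟨fun h => ⟨h.1.1, h.2⟩, fun h => ⟨⟨h.1, ?_⟩, h.2⟩⟩
    rw [← ncard_verts_permSubgraph (G := G), h.2, hk]
  · intro σ hσ
    simp only [Finset.mem_filter, Finset.mem_univ, true_and] at hσ
    exact (hmem _).2 ⟨isElementary_permSubgraph hσ.1, (ncard_verts_permSubgraph σ).trans hσ.2⟩

/-! ### Expansion of the characteristic polynomial in powers of `X - 1`. -/

open Polynomial in
theorem charpoly_normalizedLaplacian (Φ : GainGraph G) (hG : ∀ v : V, 0 < G.degree v) :
    Φ.normalizedLaplacian.charpoly = ∑ σ : Equiv.Perm V,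
      C (Φ.permWeight σ) * (X - 1) ^ (Fintype.card V - σ.support.card) := by
  -- Transposing turns the Leibniz entries `(σ i, i)` into `(i, σ i)`, the form used in
  -- `permWeight`.
  rw [Matrix.charpoly, ← Matrix.det_transpose, Matrix.det_apply']
  refine Finset.sum_congr rfl fun σ _ => ?_
  have hentry : ∀ i, Φ.normalizedLaplacian.charmatrix.transpose (σ i) i =
      if i ∈ σ.support then
        C (Φ.gainMatrix i (σ i) / (Real.sqrt (G.degree i) * Real.sqrt (G.degree (σ i)) : ℝ))
      else X - 1 := by
    intro i
    rw [Matrix.transpose_apply]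
    by_cases h : σ i = i
    · rw [if_neg (by simpa using h), h, Matrix.charmatrix_apply_eq, normalizedLaplacian,
        Matrix.of_apply, if_pos rfl, if_pos (hG i).ne', C_1]
    · rw [if_pos (by simpa using h), Matrix.charmatrix_apply_ne _ _ _ (Ne.symm h),
        normalizedLaplacian, Matrix.of_apply, if_neg (Ne.symm h), ← C_neg]
      by_cases ha : G.Adj i (σ i)
      · rw [dif_pos ha, neg_div, neg_neg, gainMatrix, dif_pos ha, Real.sqrt_mul (Nat.cast_nonneg _)]
      · rw [dif_neg ha, Φ.gainMatrix_of_not_adj ha, neg_zero, zero_div]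
  rw [Finset.prod_congr rfl fun i _ => hentry i, Finset.prod_ite]
  have hprod : ∏ i ∈ σ.support,
      (Φ.gainMatrix i (σ i) / (Real.sqrt (G.degree i) * Real.sqrt (G.degree (σ i)) : ℝ) : ℂ) =
      ∏ i ∈ σ.support, (Φ.gainMatrix i (σ i) / G.degree i) := by
    rw [Finset.prod_div_distrib, Finset.prod_div_distrib, ← Complex.ofReal_prod,
      Finset.prod_mul_distrib]
    -- `σ` permutes its support, so each square root occurs twice in the full product.
    have hre : ∏ i ∈ σ.support, Real.sqrt (G.degree (σ i)) =
        ∏ i ∈ σ.support, Real.sqrt (G.degree i) :=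
      Finset.prod_bij (fun i _ => σ i) (fun i hi => Equiv.Perm.apply_mem_support.2 hi)
        (fun i _ j _ e => σ.injective e)
        (fun j hj => ⟨σ⁻¹ j, by
          rw [← Equiv.Perm.support_inv] at hj ⊢
          exact Equiv.Perm.apply_mem_support.2 hj, σ.apply_symm_apply j⟩) fun _ _ => rfl
    rw [hre, ← Finset.prod_mul_distrib,
      Finset.prod_congr rfl fun i _ => Real.mul_self_sqrt (Nat.cast_nonneg (G.degree i)),
      Complex.ofReal_prod]
    simp
  have hf1 : Finset.univ.filter (fun i => i ∈ σ.support) = σ.support := by ext; simp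
  have hf2 : (Finset.univ.filter (fun i => i ∉ σ.support)).card =
      Fintype.card V - σ.support.card := by
    rw [← Finset.card_compl]
    congr 1
    ext
    simp
  rw [hf1, Finset.prod_const, hf2, ← map_prod, hprod, permWeight, C_mul, ← mul_assoc]
  simp

open Polynomial in
/-- Expansion of the characteristic polynomial of the normalized Laplacian in powers of
`X - 1`. -/
theorem charpoly_normalizedLaplacian_eq_sum (Φ : GainGraph G) (hG : ∀ v : V, 0 < G.degree v) :
    Φ.normalizedLaplacian.charpoly = (X - 1) ^ Fintype.card V +
      ∑ k ∈ Finset.Icc 1 (Fintype.card V),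
        C (∑ σ : Equiv.Perm V with σ.support.card = k, Φ.permWeight σ) *
          (X - 1) ^ (Fintype.card V - k) := by
  have hcard : ∀ σ ∈ (Finset.univ : Finset (Equiv.Perm V)),
      σ.support.card ∈ Finset.range (Fintype.card V + 1) := fun σ _ =>
    Finset.mem_range.2 (Nat.lt_succ_of_le (Finset.card_le_univ _))
  have hsum : ∀ k, ∑ σ : Equiv.Perm V with σ.support.card = k,
      C (Φ.permWeight σ) * (X - 1) ^ (Fintype.card V - σ.support.card) =
      C (∑ σ : Equiv.Perm V with σ.support.card = k, Φ.permWeight σ) *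
        (X - 1) ^ (Fintype.card V - k) := by
    intro k
    rw [map_sum, Finset.sum_mul]
    refine Finset.sum_congr rfl fun σ hσ => ?_
    rw [(Finset.mem_filter.1 hσ).2]
  -- Only the identity moves no point; it yields the leading term.
  have h0 : ∑ σ : Equiv.Perm V with σ.support.card = 0, Φ.permWeight σ = 1 := by
    have : Finset.univ.filter (fun σ : Equiv.Perm V => σ.support.card = 0) = {1} := by
      ext σ; simp
    rw [this, Finset.sum_singleton]
    simp [permWeight]
  rw [Φ.charpoly_normalizedLaplacian hG, ← Finset.sum_fiberwise_of_maps_to hcard,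
    Finset.sum_congr rfl fun k _ => hsum k, Finset.sum_range_eq_add_Ico _ (Nat.succ_pos _), h0,
    C_1, one_mul, Nat.sub_zero]
  rfl

end GainGraph

open Polynomial in
/-- The powers of `X - 1` are linearly independent. -/
theorem Polynomial.sum_C_mul_X_sub_one_pow_inj {R : Type*} [CommRing R] {n : ℕ} {a b : ℕ → R}
    (h : ∑ k ∈ Finset.Icc 1 n, C (a k) * (X - 1) ^ (n - k) =
      ∑ k ∈ Finset.Icc 1 n, C (b k) * (X - 1) ^ (n - k)) :
    ∀ k ∈ Finset.Icc 1 n, a k = b k := by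
  have key : ∀ d : ℕ → R, ∀ k ∈ Finset.Icc 1 n,
      ((∑ k ∈ Finset.Icc 1 n, C (d k) * (X - 1) ^ (n - k)).comp (X + 1)).coeff (n - k) = d k := by
    intro d k hk
    -- Substituting `X + 1` turns powers of `X - 1` into monomials; as `k ≤ n`, the truncated
    -- exponents `n - k` are distinct.
    have : (∑ k ∈ Finset.Icc 1 n, C (d k) * (X - 1) ^ (n - k)).comp (X + 1) =
        ∑ k ∈ Finset.Icc 1 n, C (d k) * X ^ (n - k) := by
      rw [← coe_compRingHom_apply, map_sum]
      simp
    rw [this, finsetSum_coeff, Finset.sum_eq_single_of_mem k hk]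
    · simp
    · intro j hj hne
      rw [coeff_C_mul_X_pow, if_neg]
      rw [Finset.mem_Icc] at hj hk
      omega
  intro k hk
  rw [← key a k hk, h, key b k hk]

theorem mainTheorem11 {V : Type*} [Fintype V] [DecidableEq V] (G : SimpleGraph V)
    [DecidableRel G.Adj] (Φ : GainGraph G) (hG : ∀ v : V, 0 < G.degree v) (c : ℕ → ℂ) :
    Φ.normalizedLaplacian.charpoly =
        (Polynomial.X - 1) ^ Fintype.card V +
          ∑ k ∈ Finset.Icc 1 (Fintype.card V),
            Polynomial.C (c k) * (Polynomial.X - 1) ^ (Fintype.card V - k) ↔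
      ∀ k ∈ Finset.Icc 1 (Fintype.card V),
        c k = ((∑ H ∈ G.elementarySubgraphs k,
          (-1 : ℝ) ^ H.rank * (2 : ℝ) ^ H.corank *
            ((∏ C ∈ H.cycles, Φ.reCycleGain C) / ∏ v ∈ H.vertexFinset, (G.degree v : ℝ)) : ℝ) :
              ℂ) := by
  -- With the actual expansion inserted, both directions only compare coefficients of powers of `X -
  -- 1`.
  rw [Φ.charpoly_normalizedLaplacian_eq_sum hG, add_right_inj]
  simp_rw [← Φ.sum_permWeight_card_support]
  constructor
  · intro h k hk
    exact (Polynomial.sum_C_mul_X_sub_one_pow_inj h k hk).symm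
  · intro h
    exact Finset.sum_congr rfl fun k hk => by rw [h k hk]
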